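/- Let $X$ be a real normed space. For $x,y\in X$ write $x\perp_B y$ ($x$ is Birkhoff orthogonal to $y$) if $\|x+\lambda y\|\ge\|x\|$ for all $\lambda\in\mathbb{R}$. Call $X$ an inner product space if its norm is induced by an inner product on $X$. (i) $X$ is an inner product space if and only if $$\left\|\frac{x}{\|x\|}-\frac{y}{\|y\|}\right\|\le\frac{2\|x-y\|}{\|x\|+\|y\|}\qquad\text{for all } x,y\in X\setminus\{0\}\text{ with } x\perp_B y.$$ (ii) Suppose $\dim X\ge 2$ (possibly infinite), and let $$DW_B(X)=\sup\left\{\frac{\|x\|+\|y\|}{\|x-y\|}\left\|\frac{x}{\|x\|}-\frac{y}{\|y\|}\right\| : x,y\in X\setminus\{0\},\ x\perp_B y\right\}.$$ Then $X$ is an inner product space if and only if $DW_B(X)=2$. -/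

import Mathlib

/-- `x` is Birkhoff orthogonal to `y`: `‖x + t y‖ ≥ ‖x‖` for every real `t`. -/
def BirkhoffOrthogonal {X : Type*} [NormedAddCommGroup X] [NormedSpace ℝ X] (x y : X) : Prop :=
  ∀ t : ℝ, ‖x‖ ≤ ‖x + t • y‖

/-- The quotient `(‖x‖ + ‖y‖) / ‖x - y‖ * ‖x / ‖x‖ - y / ‖y‖‖`; it is only evaluated at
nonzero `x ≠ y`. -/
noncomputable def dunklWilliamsQuotient {X : Type*} [NormedAddCommGroup X] [NormedSpace ℝ X]
    (x y : X) : ℝ :=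
  (‖x‖ + ‖y‖) / ‖x - y‖ * ‖‖x‖⁻¹ • x - ‖y‖⁻¹ • y‖

/-- The Dunkl-Williams constant `DW_B(X)` for Birkhoff orthogonality: the supremum, in the
extended reals, of the quotient over all pairs of nonzero vectors with `x ⊥_B y`
(such a pair satisfies `x ≠ y`, by taking `t = -1` in the definition of `⊥_B`). -/
noncomputable def DWB (X : Type*) [NormedAddCommGroup X] [NormedSpace ℝ X] : EReal :=
  sSup {r : EReal | ∃ x y : X, x ≠ 0 ∧ y ≠ 0 ∧ BirkhoffOrthogonal x y ∧
    r = ((dunklWilliamsQuotient x y : ℝ) : EReal)}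

/-- The normed space `X` is an inner product space: there is an inner product on the given real
vector space that induces the given norm. -/
def IsInnerProductSpace (X : Type*) [NormedAddCommGroup X] [inst : NormedSpace ℝ X] : Prop :=
  ∃ I : InnerProductSpace ℝ X, I.toNormedSpace = inst

/-! In an inner product space the inequality holds for all nonzero pairs, and an orthonormal pair
gives the quotient 2. Conversely, `DWB X = 2` implies the inequality, so it remains to deduce the
parallelogram law from the inequality. Applied to `(1 + r) • x` and `(1 - r) • y` with `x ⊥ y` unit
vectors, it says that `x - y ⊥ x + y`. The parallelogram law involves two vectors only, so the
problem is one about a norm `N` on the plane whose diagonals have this property.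

No smoothness or strict convexity is available. Still, the orthogonal pairs of unit vectors form a
curve `(x t, y t)`, parametrized by the sum of the two polar angles, along which both angles are
monotone and hence Lipschitz (`exists_orthAngles`, `OrthAngles.le_of_add_le`). Write `ω` for the
area form. Supporting-line inequalities show that `ω(x, y) / (N (x + y) * N (y - x))` has increments
of second order, so it is constant (`symp_ratio_const`). The normalized diagonals form an orthogonal
pair again, and every parameter arises from such a pair. Hence `ω(x, y)` is a constant `γ`, and `N
(x + y) * N (y - x) = 2`.

Now compare the sector areas swept by the diagonals and by the sides. With `A`, `B` the inverse
lengths of the diagonals, the difference grows at `(A - B) ^ 2` times the rate of the latter. It is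
therefore monotone; being periodic, it is constant, and `A = B`. Then `ω(x, z) ^ 2 + ω(y, z) ^ 2`
does not depend on `t`. Evaluated where `x t` points along `z` it equals `γ ^ 2 * N z ^ 2`, so `N ^
2` is a quadratic form. -/

open Filter Topology Asymptotics

/-! ### The area form and polar directions in the plane. -/

/-- The standard symplectic form on the plane. -/
def symp (z w : ℂ) : ℝ := z.re * w.im - z.im * w.re

/-- The Euclidean unit vector at angle `θ`. -/
noncomputable def dir (θ : ℝ) : ℂ := ⟨Real.cos θ, Real.sin θ⟩

/-- Birkhoff orthogonality with respect to a seminorm on the plane. -/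
def SeminormOrth (N : Seminorm ℝ ℂ) (x y : ℂ) : Prop := ∀ s : ℝ, N x ≤ N (x + s • y)

theorem symp_smul_left (r : ℝ) (z w : ℂ) : symp (r • z) w = r * symp z w := by
  simp [symp]; ring

theorem symp_smul_right (r : ℝ) (z w : ℂ) : symp z (r • w) = r * symp z w := by
  simp [symp]; ring

theorem symp_add_right (z w w' : ℂ) : symp z (w + w') = symp z w + symp z w' := by
  simp [symp]; ring

theorem symp_sub_right (z w w' : ℂ) : symp z (w - w') = symp z w - symp z w' := by
  simp [symp]; ring

theorem symp_self (z : ℂ) : symp z z = 0 := by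
  simp [symp]; ring

theorem symp_swap (z w : ℂ) : symp z w = -symp w z := by
  simp [symp]; ring

theorem symp_dir (α β : ℝ) : symp (dir α) (dir β) = Real.sin (β - α) := by
  simp [symp, dir, Real.sin_sub]; ring

theorem abs_symp_le (z w : ℂ) : |symp z w| ≤ ‖z‖ * ‖w‖ := by
  have h : symp z w = ((starRingEnd ℂ) z * w).im := by simp [symp]; ring
  rw [h]
  refine (Complex.abs_im_le_norm _).trans ?_
  simp

theorem symp_plucker (x x' y y' : ℂ) :
    symp x' y * symp x y' - symp x y * symp x' y' = - symp x x' * symp y y' := by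
  simp [symp]; ring

theorem symp_smul_eq (x y z : ℂ) : symp x y • z = symp z y • x + symp x z • y := by
  apply Complex.ext <;> simp [symp] <;> ring

theorem norm_dir (θ : ℝ) : ‖dir θ‖ = 1 := by
  have h : ‖dir θ‖ ^ 2 = 1 := by
    rw [← Complex.normSq_eq_norm_sq, Complex.normSq_apply]
    simp only [dir]
    nlinarith [Real.sin_sq_add_cos_sq θ]
  nlinarith [norm_nonneg (dir θ)]

theorem dir_ne_zero (θ : ℝ) : dir θ ≠ 0 := by
  rw [← norm_pos_iff, norm_dir]; exact one_pos

theorem dir_add_pi (θ : ℝ) : dir (θ + Real.pi) = - dir θ := by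
  apply Complex.ext <;> simp [dir]

theorem dir_eq_exp (θ : ℝ) : dir θ = Complex.exp (θ * Complex.I) := by
  apply Complex.ext
  · simp [dir, Complex.exp_ofReal_mul_I_re]
  · simp [dir, Complex.exp_ofReal_mul_I_im]

theorem norm_smul_dir_arg (z : ℂ) : ‖z‖ • dir (Complex.arg z) = z := by
  rw [dir_eq_exp, Complex.real_smul, Complex.norm_mul_exp_arg_mul_I]

theorem dir_add (α β : ℝ) : dir (α + β) = dir α * dir β := by
  simp only [dir_eq_exp, ← Complex.exp_add]
  congr 1; push_cast; ring

/-! ### Seminorms on the plane and supporting lines. -/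

section Seminorm

variable {N : Seminorm ℝ ℂ}

theorem seminorm_smul (r : ℝ) (z : ℂ) : N (r • z) = |r| * N z := by
  rw [map_smul_eq_mul, Real.norm_eq_abs]

theorem seminorm_le_mul_norm (N : Seminorm ℝ ℂ) (z : ℂ) :
    N z ≤ (N 1 + N Complex.I) * ‖z‖ := by
  have h : z = z.re • (1 : ℂ) + z.im • Complex.I := by
    apply Complex.ext <;> simp
  have h1 : N z ≤ |z.re| * N 1 + |z.im| * N Complex.I := by
    conv_lhs => rw [h]
    refine (map_add_le_add N _ _).trans ?_
    rw [seminorm_smul, seminorm_smul]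
  have := mul_le_mul_of_nonneg_right (Complex.abs_re_le_norm z) (apply_nonneg N 1)
  have := mul_le_mul_of_nonneg_right (Complex.abs_im_le_norm z) (apply_nonneg N Complex.I)
  linarith

theorem abs_seminorm_sub_le (N : Seminorm ℝ ℂ) (z w : ℂ) :
    |N z - N w| ≤ (N 1 + N Complex.I) * ‖z - w‖ :=
  (abs_sub_map_le_sub N z w).trans (seminorm_le_mul_norm N _)

theorem seminorm_continuous (N : Seminorm ℝ ℂ) : Continuous N := by
  have : LipschitzWith (Real.toNNReal (N 1 + N Complex.I)) N := by
    apply LipschitzWith.of_dist_le_mul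
    intro z w
    rw [Real.dist_eq, dist_eq_norm, Real.coe_toNNReal]
    · exact abs_seminorm_sub_le N z w
    · exact add_nonneg (apply_nonneg N _) (apply_nonneg N _)
  exact this.continuous

theorem SeminormOrth.smul {x y : ℂ} (h : SeminormOrth N x y) (r c : ℝ) :
    SeminormOrth N (r • x) (c • y) := by
  intro s
  rcases eq_or_ne r 0 with rfl | hr
  · simp
  · have e : r • x + s • c • y = r • (x + (r⁻¹ * (s * c)) • y) := by
      rw [smul_add, smul_smul, smul_smul, ← mul_assoc, mul_inv_cancel₀ hr, one_mul]
    rw [e, seminorm_smul, seminorm_smul]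
    exact mul_le_mul_of_nonneg_left (h _) (abs_nonneg r)

/-- Orthogonality means that the line through `x` in direction `y` supports the ball of radius `N
x`. The functional `symp · y` is constant on that line, so this is the supporting functional at `x`.
-/
theorem SeminormOrth.symp_mul_le {x y : ℂ} (h : SeminormOrth N x y) (hxy : 0 < symp x y) (z : ℂ) :
    symp z y * N x ≤ symp x y * N z := by
  rcases le_or_gt (symp z y) 0 with h0 | h0
  · exact (mul_nonpos_of_nonpos_of_nonneg h0 (apply_nonneg N x)).trans
      (mul_nonneg hxy.le (apply_nonneg N z))
  · have e : symp x y • z = symp z y • (x + (symp x z / symp z y) • y) := by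
      rw [symp_smul_eq, smul_add, smul_smul, mul_div_cancel₀ _ h0.ne']
    have e2 : symp x y * N z = symp z y * N (x + (symp x z / symp z y) • y) := by
      rw [← abs_of_pos hxy, ← seminorm_smul, e, seminorm_smul, abs_of_pos h0]
    rw [e2]
    exact mul_le_mul_of_nonneg_left (h _) h0.le

/-- A local quadratic lower bound along a line through `x` already forces `x` to be orthogonal
to the direction of that line, by convexity. -/
theorem seminormOrth_of_sq_ge {x y : ℂ} (hx : 0 < N x)
    (h : ∀ s : ℝ, N x ^ 2 * (1 - s ^ 2) ≤ N (x + s • y) ^ 2) : SeminormOrth N x y := by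
  intro s
  by_contra! hlt
  set d := N x - N (x + s • y) with hd
  have hd0 : 0 < d := by linarith
  have hdx : d ≤ N x := by linarith [apply_nonneg N (x + s • y)]
  have hcv : ∀ l : ℝ, 0 ≤ l → l ≤ 1 → N (x + (l * s) • y) ≤ N x - l * d := by
    intro l h0 h1
    have e : x + (l * s) • y = (1 - l) • x + l • (x + s • y) := by
      rw [smul_add, smul_smul, sub_smul, one_smul]; abel
    rw [e]
    refine (map_add_le_add N _ _).trans ?_
    rw [seminorm_smul, seminorm_smul, abs_of_nonneg h0, abs_of_nonneg (by linarith)]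
    rw [hd]; apply le_of_eq; ring
  -- Squaring the convexity bound at `l * s` and comparing with the hypothesis gives `2 * d * N x ≤
  -- l * K`, which fails for small `l`.
  set K := d ^ 2 + N x ^ 2 * s ^ 2 with hK
  have hK0 : 0 < K := by positivity
  obtain ⟨l, hl0, hl1, hlK⟩ : ∃ l : ℝ, 0 < l ∧ l ≤ 1 ∧ l * K ≤ d * N x := by
    refine ⟨min 1 (d * N x / K), by positivity, min_le_left _ _, ?_⟩
    calc min 1 (d * N x / K) * K ≤ d * N x / K * K :=
          mul_le_mul_of_nonneg_right (min_le_right _ _) hK0.le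
      _ = d * N x := div_mul_cancel₀ _ hK0.ne'
  have h1 := h (l * s)
  have h2 := pow_le_pow_left₀ (apply_nonneg N _) (hcv l hl0.le hl1) 2
  have h3 : l * (2 * (d * N x)) ≤ l * (l * K) := by rw [hK]; nlinarith
  have h4 := le_of_mul_le_mul_left h3 hl0
  have : 0 < d * N x := mul_pos hd0 hx
  linarith

end Seminorm

/-! ### Orthogonal pairs of angles: monotonicity, uniqueness, existence. -/

/-- Angles `α < β < α + π` whose unit vectors are Birkhoff orthogonal. -/
structure OrthAngles (N : Seminorm ℝ ℂ) (α β : ℝ) : Prop where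
  lt : α < β
  lt_add_pi : β < α + Real.pi
  orth : SeminormOrth N (dir α) (dir β)

section Angles

variable {N : Seminorm ℝ ℂ}

/-- If `α < α' < β' < β`, multiplying the supporting inequalities of the two pairs, each tested on
the other's first vector, contradicts the sign in the Plücker identity. -/
theorem OrthAngles.mono (hN : ∀ z, z ≠ 0 → 0 < N z)
    {α β α' β' : ℝ} (h : OrthAngles N α β) (h' : OrthAngles N α' β')
    (hlt : α < α') : β ≤ β' := by
  by_contra! hb
  have l1 := h.lt; have l2 := h.lt_add_pi; have l3 := h'.lt; have l4 := h'.lt_add_pi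
  have s1 : 0 < symp (dir α) (dir β) := by
    rw [symp_dir]; exact Real.sin_pos_of_pos_of_lt_pi (by linarith) (by linarith)
  have s2 : 0 < symp (dir α') (dir β') := by
    rw [symp_dir]; exact Real.sin_pos_of_pos_of_lt_pi (by linarith) (by linarith)
  have s3 : 0 < symp (dir α) (dir β') := by
    rw [symp_dir]; exact Real.sin_pos_of_pos_of_lt_pi (by linarith) (by linarith)
  have s4 : 0 < symp (dir α') (dir β) := by
    rw [symp_dir]; exact Real.sin_pos_of_pos_of_lt_pi (by linarith) (by linarith)
  have s5 : 0 < symp (dir α) (dir α') := by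
    rw [symp_dir]; exact Real.sin_pos_of_pos_of_lt_pi (by linarith) (by linarith)
  have s6 : symp (dir β) (dir β') < 0 := by
    rw [symp_swap, symp_dir, neg_lt_zero]
    exact Real.sin_pos_of_pos_of_lt_pi (by linarith) (by linarith)
  have i1 := h.orth.symp_mul_le s1 (dir α')
  have i2 := h'.orth.symp_mul_le s2 (dir α)
  have n1 := hN _ (dir_ne_zero α)
  have n2 := hN _ (dir_ne_zero α')
  have i3 := mul_le_mul i1 i2 (mul_pos s3 n2).le (mul_pos s1 n2).le
  have i4 : symp (dir α') (dir β) * symp (dir α) (dir β')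
      ≤ symp (dir α) (dir β) * symp (dir α') (dir β') := by
    refine le_of_mul_le_mul_right ?_ (mul_pos n1 n2)
    linarith
  have := symp_plucker (dir α) (dir α') (dir β) (dir β')
  nlinarith

/-- An angle alone need not determine its orthogonal partner, since `N` may have corners or flat
sides. By monotonicity the sum of the angles does determine the pair, which makes it a good
parameter. -/
theorem OrthAngles.le_of_add_le (hN : ∀ z, z ≠ 0 → 0 < N z)
    {α β α' β' : ℝ} (h : OrthAngles N α β) (h' : OrthAngles N α' β')
    (hle : α + β ≤ α' + β') : α ≤ α' ∧ β ≤ β' := by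
  have key : α ≤ α' := by
    by_contra! hlt
    have := h'.mono hN h hlt
    linarith
  refine ⟨key, ?_⟩
  rcases key.lt_or_eq with hlt | heq
  · exact h.mono hN h' hlt
  · linarith

theorem OrthAngles.unique (hN : ∀ z, z ≠ 0 → 0 < N z)
    {α β α' β' : ℝ} (h : OrthAngles N α β) (h' : OrthAngles N α' β')
    (he : α + β = α' + β') : α = α' ∧ β = β' := by
  have h1 := h.le_of_add_le hN h' he.le
  have h2 := h'.le_of_add_le hN h he.ge
  exact ⟨le_antisymm h1.1 h2.1, le_antisymm h1.2 h2.2⟩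

/-- Variational: maximize `q / N ^ 2` for the quadratic form `q` below. On the line from a maximizer
`dir α` in direction `dir (t - α)`, `q` is `q (dir α) * (1 - s ^ 2)`, so maximality is precisely the
local bound that forces orthogonality. -/
theorem exists_orthAngles (hN : ∀ z, z ≠ 0 → 0 < N z)
    (t : ℝ) : ∃ α β, OrthAngles N α β ∧ α + β = t := by
  -- `q z = ‖z‖² sin (t - 2 arg z)`
  set q : ℂ → ℝ := fun z => Real.sin t * (z.re ^ 2 - z.im ^ 2) - Real.cos t * (2 * z.re * z.im)
    with hq
  have qc : Continuous q := by
    simp only [hq]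
    fun_prop
  have qdir : ∀ θ, q (dir θ) = Real.sin (t - 2 * θ) := by
    intro θ
    simp only [hq, dir, Real.sin_sub, Real.sin_two_mul, Real.cos_two_mul']
    ring
  have qs : ∀ (r : ℝ) z, q (r • z) = r ^ 2 * q z := by
    intro r z; simp [hq]; ring
  have hNc := seminorm_continuous N
  obtain ⟨z₀, hz₀, hmax⟩ := (isCompact_sphere (0 : ℂ) 1).exists_isMaxOn
    (f := fun z => q z / N z ^ 2) ⟨1, by simp⟩ (by
      apply ContinuousOn.div qc.continuousOn (hNc.pow 2).continuousOn
      intro z hz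
      have : z ≠ 0 := by
        rintro rfl; simp at hz
      exact (pow_pos (hN z this) 2).ne')
  have hmax' : ∀ z : ℂ, ‖z‖ = 1 → q z / N z ^ 2 ≤ q z₀ / N z₀ ^ 2 := fun z hz => hmax (by simpa using hz)
  have hz₀n : ‖z₀‖ = 1 := by simpa using hz₀
  have hz₀0 : z₀ ≠ 0 := by rintro rfl; simp at hz₀n
  have hqpos : 0 < q z₀ := by
    have h1 := hmax' (dir ((t - Real.pi / 2) / 2)) (norm_dir _)
    have h2 : q (dir ((t - Real.pi / 2) / 2)) = 1 := by
      rw [qdir, show t - 2 * ((t - Real.pi / 2) / 2) = Real.pi / 2 by ring, Real.sin_pi_div_two]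
    rw [h2] at h1
    have h3 := pow_pos (hN _ (dir_ne_zero ((t - Real.pi / 2) / 2))) 2
    have h4 := pow_pos (hN _ hz₀0) 2
    have h5 : 0 < q z₀ / N z₀ ^ 2 := lt_of_lt_of_le (by positivity) h1
    exact (div_pos_iff_of_pos_right h4).1 h5
  -- Shifting the argument by a multiple of `π` changes `z₀` at most by a sign. Since `0 < q z₀`,
  -- some shift brings `t - 2 * α` into `(0, π)`.
  obtain ⟨α, hα0, hαπ, hα⟩ : ∃ α, 0 < t - 2 * α ∧ t - 2 * α < Real.pi ∧ (dir α = z₀ ∨ dir α = -z₀) := by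
    set η := t - 2 * Complex.arg z₀ with hη
    have hd : dir (Complex.arg z₀) = z₀ := by
      have := norm_smul_dir_arg z₀; rwa [hz₀n, one_smul] at this
    have hs : 0 < Real.sin η := by rw [hη, ← qdir, hd]; exact hqpos
    set k := ⌊η / (2 * Real.pi)⌋ with hk
    have hpi := Real.pi_pos
    have k1 : (k : ℝ) * (2 * Real.pi) ≤ η := by
      rw [← le_div_iff₀ (by positivity)]; exact Int.floor_le _
    have k2 : η < (k + 1) * (2 * Real.pi) := by
      rw [← div_lt_iff₀ (by positivity)]; exact Int.lt_floor_add_one _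
    have hs' : Real.sin (η - k * (2 * Real.pi)) = Real.sin η := Real.sin_sub_int_mul_two_pi _ _
    refine ⟨Complex.arg z₀ + k * Real.pi, ?_, ?_, ?_⟩
    · rcases k1.lt_or_eq with h | h
      · linarith
      · rw [h, sub_self, Real.sin_zero] at hs'
        linarith
    · by_contra! hge
      have : Real.sin (η - k * (2 * Real.pi) - Real.pi) ≥ 0 :=
        Real.sin_nonneg_of_nonneg_of_le_pi (by linarith) (by linarith)
      rw [Real.sin_sub_pi] at this
      linarith
    · rw [dir_add, hd]
      rcases Int.even_or_odd k with h | h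
      · left
        have : dir (k * Real.pi) = 1 := by
          apply Complex.ext
          · simp [dir, Real.cos_int_mul_pi, h.neg_one_zpow]
          · simp [dir, Real.sin_int_mul_pi]
        rw [this, mul_one]
      · right
        have : dir (k * Real.pi) = -1 := by
          apply Complex.ext
          · simp [dir, Real.cos_int_mul_pi, h.neg_one_zpow]
          · simp [dir, Real.sin_int_mul_pi]
        rw [this]; ring
  have hNα : N (dir α) = N z₀ := by
    rcases hα with h | h <;> simp [h]
  have hqα : q (dir α) = q z₀ := by
    rcases hα with h | h
    · rw [h]
    · have := qs (-1) z₀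
      rw [h]; simpa using this
  have hglob : ∀ z, q z * N (dir α) ^ 2 ≤ q (dir α) * N z ^ 2 := by
    intro z
    rcases eq_or_ne z 0 with rfl | hz
    · simp [hq]
    · have hnz : 0 < ‖z‖ := norm_pos_iff.2 hz
      have h1 := hmax' (‖z‖⁻¹ • z) (by rw [norm_smul, norm_inv, norm_norm, inv_mul_cancel₀ hnz.ne'])
      rw [qs, seminorm_smul, mul_pow, sq_abs, mul_div_mul_left _ _ (by positivity)] at h1
      rw [div_le_div_iff₀ (pow_pos (hN _ hz) 2) (pow_pos (hN _ hz₀0) 2)] at h1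
      rwa [hNα, hqα]
  refine ⟨α, t - α, ⟨by linarith, by linarith, ?_⟩, by ring⟩
  apply seminormOrth_of_sq_ge (hN _ (dir_ne_zero _))
  intro s
  have h1 := hglob (dir α + s • dir (t - α))
  have h2 : q (dir α + s • dir (t - α)) = q (dir α) * (1 - s ^ 2) := by
    have e : t = α + (t - α) := by ring
    set β := t - α
    simp only [hq, dir, e, Real.sin_add, Real.cos_add]
    simp
    have c1 := Real.sin_sq_add_cos_sq α
    have c2 := Real.sin_sq_add_cos_sq β
    generalize Real.sin α = a at *
    generalize Real.cos α = b at *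
    generalize Real.sin β = c at *
    generalize Real.cos β = d at *
    linear_combination s ^ 2 * (a * d - b * c) * (c2 - c1)
  rw [h2, mul_assoc] at h1
  have h3 := le_of_mul_le_mul_left h1 (by rw [hqα]; exact hqpos)
  linarith

end Angles

/-! ### Calculus of pointwise Lipschitz functions. -/

/-- `f` is pointwise Lipschitz at `t`. -/
def LipAt {E : Type*} [NormedAddCommGroup E] (f : ℝ → E) (t : ℝ) : Prop :=
  (fun s => f s - f t) =O[𝓝 t] fun s => s - t

section LipAt

variable {E : Type*} [NormedAddCommGroup E] {f g : ℝ → E} {t : ℝ}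

theorem LipAt.continuousAt (h : LipAt f t) : ContinuousAt f t := by
  have h1 : Tendsto (fun s : ℝ => s - t) (𝓝 t) (𝓝 0) := by
    have : Continuous fun s : ℝ => s - t := by fun_prop
    simpa using this.tendsto t
  have h2 := IsBigO.trans_tendsto h h1
  exact tendsto_sub_nhds_zero_iff.1 h2

theorem LipAt.add (hf : LipAt f t) (hg : LipAt g t) : LipAt (fun s => f s + g s) t :=
  (IsBigO.add hf hg).congr_left fun s => (add_sub_add_comm (f s) (g s) (f t) (g t)).symm

theorem LipAt.sub (hf : LipAt f t) (hg : LipAt g t) : LipAt (fun s => f s - g s) t :=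
  (IsBigO.sub hf hg).congr_left fun s => (sub_sub_sub_comm (f s) (g s) (f t) (g t)).symm

theorem LipAt.comp_hasFDerivAt {F G : Type*} [NormedAddCommGroup F] [NormedSpace ℝ F]
    [NormedAddCommGroup G] [NormedSpace ℝ G] {φ : F → G} {f : ℝ → F}
    {φ' : F →L[ℝ] G} (hφ : HasFDerivAt φ φ' (f t)) (hf : LipAt f t) :
    LipAt (fun s => φ (f s)) t :=
  (hφ.isBigO_sub.comp_tendsto hf.continuousAt).trans hf

theorem LipAt.seminorm {f : ℝ → ℂ} (N : Seminorm ℝ ℂ) (hf : LipAt f t) :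
    LipAt (fun s => N (f s)) t :=
  (IsBigO.of_bound (N 1 + N Complex.I)
    (Eventually.of_forall fun s => abs_seminorm_sub_le N (f s) (f t))).trans hf

theorem LipAt.inv {f : ℝ → ℝ} (hf : LipAt f t) (h0 : f t ≠ 0) : LipAt (fun s => (f s)⁻¹) t :=
  LipAt.comp_hasFDerivAt (hasDerivAt_inv h0).hasFDerivAt hf

theorem LipAt.smul {f : ℝ → ℝ} {g : ℝ → ℂ} (hf : LipAt f t) (hg : LipAt g t) :
    LipAt (fun s => f s • g s) t := by
  have h1 : (fun s => (f s - f t) • g s) =O[𝓝 t] fun s => (s - t) • (1 : ℝ) :=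
    IsBigO.smul hf (hg.continuousAt.tendsto.isBigO_one ℝ)
  have h2 : (fun s => f t • (g s - g t)) =O[𝓝 t] fun s => s - t := IsBigO.const_smul_left hg (f t)
  have h3 : (fun s => (f s - f t) • g s) =O[𝓝 t] fun s => s - t := h1.congr_right fun s => by simp
  refine (h3.add h2).congr_left fun s => ?_
  rw [sub_smul, smul_sub]; abel

theorem isLittleO_sub_mul_sub (t : ℝ) :
    (fun s : ℝ => (s - t) * (s - t)) =o[𝓝 t] fun s => s - t := by
  have h1 : (fun s : ℝ => s - t) =o[𝓝 t] fun _ => (1 : ℝ) := by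
    rw [isLittleO_one_iff]
    have : Continuous fun s : ℝ => s - t := by fun_prop
    simpa using this.tendsto t
  simpa using h1.mul_isBigO (isBigO_refl (fun s : ℝ => s - t) (𝓝 t))

theorem isBigO_symp {l : Filter ℝ} {u v : ℝ → ℂ} {φ χ : ℝ → ℝ} (hu : u =O[l] φ) (hv : v =O[l] χ) :
    (fun s => symp (u s) (v s)) =O[l] fun s => φ s * χ s := by
  refine IsBigO.trans (IsBigO.of_bound 1 (Eventually.of_forall fun s => ?_))
    (hu.norm_left.mul hv.norm_left)
  simpa using abs_symp_le (u s) (v s)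

theorem LipAt.isBigO_symp_sub {f : ℝ → ℂ} (z : ℂ) (hf : LipAt f t) :
    (fun s => symp (f s - f t) z) =O[𝓝 t] fun s => s - t := by
  simpa using isBigO_symp hf (isBigO_const_const z (one_ne_zero (α := ℝ)) (𝓝 t))

theorem eq_of_forall_isLittleO {f : ℝ → ℝ}
    (h : ∀ t, (fun s => f s - f t) =o[𝓝 t] fun s => s - t) (s t : ℝ) : f s = f t := by
  have hd : ∀ t, HasDerivAt f 0 t := fun t => by
    rw [hasDerivAt_iff_isLittleO]
    simpa using h t
  exact is_const_of_deriv_eq_zero (fun t => (hd t).differentiableAt) (fun t => (hd t).deriv) s t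

/-- A function whose increments agree to first order with nonnegative multiples of the increments
of a monotone function is monotone. -/
theorem monotone_of_isLittleO {f S κ : ℝ → ℝ} (hf : Continuous f) (hS : Monotone S)
    (hκ : ∀ t, 0 ≤ κ t)
    (h : ∀ t, (fun s => f s - f t - κ t * (S s - S t)) =o[𝓝 t] fun s => s - t) : Monotone f := by
  intro a b hab
  have key := image_le_of_liminf_slope_right_le_deriv_boundary (f := fun s => - f s) (a := a) (b := b)
    hf.neg.continuousOn (B := fun _ => - f a) (B' := fun _ => 0) le_rfl continuousOn_const
    (fun x _ => hasDerivWithinAt_const _ _ _) (by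
      intro x _ r hr
      apply Eventually.frequently
      have h1 := (h x).def (half_pos hr)
      filter_upwards [nhdsWithin_le_nhds h1, self_mem_nhdsWithin] with z hz hxz
      have hxz' : 0 < z - x := sub_pos.2 hxz
      rw [slope_def_field, div_lt_iff₀ hxz']
      rw [Real.norm_eq_abs, Real.norm_eq_abs, abs_of_pos hxz'] at hz
      have h2 := (abs_le.1 hz).1
      have h3 : 0 ≤ κ x * (S z - S x) := mul_nonneg (hκ x) (sub_nonneg.2 (hS hxz.le))
      have h4 : 0 < r * (z - x) := mul_pos hr hxz'
      linarith)
  have := key (Set.right_mem_Icc.2 hab)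
  linarith

end LipAt

/-! ### Curves of orthogonal pairs and their invariants. -/

theorem symp_add_sub (x y : ℂ) : symp (x + y) (y - x) = 2 * symp x y := by
  simp [symp]; ring

/-- A curve of Birkhoff orthogonal unit vectors `x ⊥ y` for which the diagonals `x + y`, `y - x`
are orthogonal to each other. -/
structure OrthCurve (N : Seminorm ℝ ℂ) (x y : ℝ → ℂ) : Prop where
  unit_left : ∀ t, N (x t) = 1
  unit_right : ∀ t, N (y t) = 1
  pos : ∀ t, 0 < symp (x t) (y t)
  orth : ∀ t, SeminormOrth N (x t) (y t)
  add_orth : ∀ t, SeminormOrth N (x t + y t) (y t - x t)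
  sub_orth : ∀ t, SeminormOrth N (y t - x t) (x t + y t)
  lip_left : ∀ t, LipAt x t
  lip_right : ∀ t, LipAt y t

namespace OrthCurve

variable {N : Seminorm ℝ ℂ} {x y : ℝ → ℂ}

theorem continuous_left (H : OrthCurve N x y)
    : Continuous x :=
  continuous_iff_continuousAt.2 fun t => (H.lip_left t).continuousAt

theorem continuous_right (H : OrthCurve N x y)
    : Continuous y :=
  continuous_iff_continuousAt.2 fun t => (H.lip_right t).continuousAt

theorem continuous_symp (H : OrthCurve N x y)
    : Continuous fun t => symp (x t) (y t) := by
  have := H.continuous_left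
  have := H.continuous_right
  unfold symp
  fun_prop

theorem symp_le (H : OrthCurve N x y)
    (s t : ℝ) : symp (x s) (y t) ≤ symp (x t) (y t) := by
  have := (H.orth t).symp_mul_le (H.pos t) (x s)
  rwa [H.unit_left, H.unit_left, mul_one, mul_one] at this

/-- The supporting line at `x t + y t`, tested on the diagonal at parameter `s`; `sub_mul_le` does
the same for the other diagonal. -/
theorem add_mul_le (H : OrthCurve N x y)
    (s t : ℝ) :
    N (x t + y t) * (symp (x s) (y t) + symp (x t) (y s) +
      (symp (x t) (x s) - symp (y t) (y s))) ≤ 2 * symp (x t) (y t) * N (x s + y s) := by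
  have h := (H.add_orth t).symp_mul_le (by rw [symp_add_sub]; linarith [H.pos t]) (x s + y s)
  rw [symp_add_sub] at h
  refine le_trans (le_of_eq ?_) h
  simp [symp]; ring

theorem sub_mul_le (H : OrthCurve N x y)
    (s t : ℝ) :
    N (y t - x t) * (symp (x s) (y t) + symp (x t) (y s) -
      (symp (x t) (x s) - symp (y t) (y s))) ≤ 2 * symp (x t) (y t) * N (y s - x s) := by
  have e : symp (y t - x t) (-(x t + y t)) = 2 * symp (x t) (y t) := by simp [symp]; ring
  have h0 : SeminormOrth N (y t - x t) (-(x t + y t)) := by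
    have h := (H.sub_orth t).smul 1 (-1)
    rwa [one_smul, neg_one_smul] at h
  have h := h0.symp_mul_le (by rw [e]; linarith [H.pos t]) (y s - x s)
  rw [e] at h
  refine le_trans (le_of_eq ?_) h
  simp [symp]; ring

theorem isBigO_symp_increments (H : OrthCurve N x y)
    (t : ℝ) :
    (fun s => symp (x s - x t) (y s - y t)) =O[𝓝 t] fun s => (s - t) * (s - t) :=
  isBigO_symp (H.lip_left t) (H.lip_right t)

theorem isBigO_symp_left (H : OrthCurve N x y)
    (t : ℝ) :
    (fun s => symp (x t) (x s)) =O[𝓝 t] fun s => s - t := by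
  refine ((H.lip_left t).isBigO_symp_sub (x t)).neg_left.congr_left fun s => ?_
  simp [symp]; ring

theorem isBigO_symp_right (H : OrthCurve N x y)
    (t : ℝ) :
    (fun s => symp (y t) (y s)) =O[𝓝 t] fun s => s - t := by
  refine ((H.lip_right t).isBigO_symp_sub (y t)).neg_left.congr_left fun s => ?_
  simp [symp]; ring

theorem isBigO_symp_value (H : OrthCurve N x y)
    (t : ℝ) :
    (fun s => symp (x s) (y s) - symp (x t) (y t)) =O[𝓝 t] fun s => s - t := by
  have h1 := (H.lip_left t).isBigO_symp_sub (y t)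
  have h2 : (fun s => symp (x s) (y s - y t)) =O[𝓝 t] fun s => 1 * (s - t) :=
    isBigO_symp (H.continuous_left.continuousAt.tendsto.isBigO_one ℝ) (H.lip_right t)
  simp only [one_mul] at h2
  refine (h1.add h2).congr_left fun s => ?_
  simp [symp]; ring

end OrthCurve

/-- The product of the two diagonal inequalities bounds `c ^ 2 - d ^ 2`. So the increment of `g / (a
* b)` is controlled by how far `c ^ 2 - d ^ 2` is from `4 * g * g'`, a second-order quantity along
the curve. -/
theorem ratio_increment_le {a b a' b' g g' c d : ℝ} (ha : 0 < a) (hb : 0 < b) (ha' : 0 < a')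
    (hb' : 0 < b') (hg : 0 < g) (hg' : 0 < g') (hc : 0 ≤ c)
    (h1 : a * (c + d) ≤ 2 * g * a') (h2 : b * (c - d) ≤ 2 * g * b') :
    4 * g * g' * (g' / (a' * b') - g / (a * b))
      ≤ |c ^ 2 - d ^ 2 - 4 * g * g'| * (g' / (a' * b')) := by
  have key : a * b * (c ^ 2 - d ^ 2) ≤ 4 * g ^ 2 * (a' * b') := by
    rcases le_or_gt (c ^ 2 - d ^ 2) 0 with h | h
    · exact (mul_nonpos_of_nonneg_of_nonpos (by positivity) h).trans (by positivity)
    · have h3 : |d| < c := by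
        rw [← abs_of_nonneg hc]; exact sq_lt_sq.1 (by linarith)
      have h4 := abs_lt.1 h3
      have := mul_le_mul h1 h2 (mul_nonneg hb.le (by linarith)) (by positivity)
      nlinarith
  have e : (c ^ 2 - d ^ 2) * (g' / (a' * b')) ≤ 4 * g * g' * (g / (a * b)) := by
    have e1 : (c ^ 2 - d ^ 2) * (g' / (a' * b')) = (a * b * (c ^ 2 - d ^ 2)) * g' / (a * b * (a' * b')) := by
      field_simp
    have e2 : 4 * g * g' * (g / (a * b)) = (4 * g ^ 2 * (a' * b')) * g' / (a * b * (a' * b')) := by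
      field_simp
    rw [e1, e2]
    gcongr
  have h5 : 0 < g' / (a' * b') := by positivity
  have h6 := mul_le_mul_of_nonneg_right (neg_abs_le (c ^ 2 - d ^ 2 - 4 * g * g')) h5.le
  nlinarith

namespace OrthCurve

variable {N : Seminorm ℝ ℂ} {x y : ℝ → ℂ}

/-- `ratio_increment_le`, used with `s` and `t` in both roles, bounds the increment on both sides by
`O((s - t) ^ 2)`, so the derivative exists and vanishes. -/
theorem symp_ratio_const (H : OrthCurve N x y)
    (hN : ∀ z, z ≠ 0 → 0 < N z) (s t : ℝ) :
    symp (x s) (y s) / (N (x s + y s) * N (y s - x s)) =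
      symp (x t) (y t) / (N (x t + y t) * N (y t - x t)) := by
  have apos : ∀ t, 0 < N (x t + y t) := fun t => hN _ fun h => by
    have := symp_add_sub (x t) (y t); rw [h] at this
    have h2 := H.pos t
    simp [symp] at this h2; linarith
  have bpos : ∀ t, 0 < N (y t - x t) := fun t => hN _ fun h => by
    have := symp_add_sub (x t) (y t); rw [h] at this
    have h2 := H.pos t
    simp [symp] at this h2; linarith
  set h : ℝ → ℝ := fun t => symp (x t) (y t) / (N (x t + y t) * N (y t - x t)) with hh
  have hcont : Continuous h := by
    have h1 := H.continuous_symp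
    have h2 := H.continuous_left
    have h3 := H.continuous_right
    have h4 := seminorm_continuous N
    exact h1.div ((h4.comp (h2.add h3)).mul (h4.comp (h3.sub h2)))
      fun t => (mul_pos (apos t) (bpos t)).ne'
  have hpos : ∀ t, 0 < h t := fun t => div_pos (H.pos t) (mul_pos (apos t) (bpos t))
  refine eq_of_forall_isLittleO (f := h) (fun t => ?_) s t
  set g : ℝ → ℝ := fun t => symp (x t) (y t) with hg
  set c : ℝ → ℝ := fun s => symp (x s) (y t) + symp (x t) (y s) with hc
  set d : ℝ → ℝ := fun s => symp (x t) (x s) - symp (y t) (y s) with hd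
  set n : ℝ → ℝ := fun s => c s ^ 2 - d s ^ 2 - 4 * g t * g s with hn
  have hw : ∀ s, c s = g t + g s - symp (x s - x t) (y s - y t) := by
    intro s; simp only [hc, hg]; simp [symp]; ring
  have w0 := H.isBigO_symp_increments t
  -- With `w` the area of the two increments and `c = g t + g s - w`, one has `n = (g s - g t) ^ 2 -
  -- d ^ 2 - w * (c + g t + g s)`, each term of second order.
  have nO : n =O[𝓝 t] fun s => (s - t) * (s - t) := by
    have gO := H.isBigO_symp_value t
    have dO : d =O[𝓝 t] fun s => s - t := (H.isBigO_symp_left t).sub (H.isBigO_symp_right t)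
    have cO : (fun s => c s + g t + g s) =O[𝓝 t] fun _ => (1 : ℝ) := by
      have : Continuous fun s => c s + g t + g s := by
        have h2 := H.continuous_left
        have h3 := H.continuous_right
        simp only [hc, hg, symp]
        fun_prop
      exact this.continuousAt.tendsto.isBigO_one ℝ
    have o1 := gO.mul gO
    have o2 := dO.mul dO
    have o3 := w0.mul cO
    simp only [mul_one] at o3
    refine ((o1.sub o2).sub o3).congr_left fun s => ?_
    have := hw s
    simp only [hn]
    have e : symp (x s - x t) (y s - y t) = g t + g s - c s := by linarith
    rw [e]; ring
  have KO : (fun s => (h s + h t) / (4 * g t * g s)) =O[𝓝 t] fun _ => (1 : ℝ) := by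
    have : Continuous fun s => (h s + h t) / (4 * g t * g s) := by
      refine (hcont.add continuous_const).div (continuous_const.mul H.continuous_symp) fun s => ?_
      have := H.pos s; have := H.pos t
      positivity
    exact this.continuousAt.tendsto.isBigO_one ℝ
  have tot := nO.mul KO
  simp only [mul_one] at tot
  refine IsBigO.trans_isLittleO ?_ (isLittleO_sub_mul_sub t)
  refine IsBigO.trans (IsBigO.of_bound 1 ?_) tot
  have hcpos : ∀ᶠ s in 𝓝 t, 0 < c s := by
    have : Continuous c := by
      have h2 := H.continuous_left
      have h3 := H.continuous_right
      simp only [hc, symp]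
      fun_prop
    apply this.continuousAt.eventually_const_lt
    have := H.pos t
    simp only [hc]; linarith
  filter_upwards [hcpos] with s hcs
  have i1 := ratio_increment_le (apos t) (bpos t) (apos s) (bpos s) (H.pos t) (H.pos s) hcs.le
    (H.add_mul_le s t) (H.sub_mul_le s t)
  have i2 := ratio_increment_le (a := N (x s + y s)) (b := N (y s - x s)) (d := - d s)
    (apos s) (bpos s) (apos t) (bpos t) (H.pos s) (H.pos t) hcs.le
    (by
      have := H.add_mul_le t s
      refine le_trans (le_of_eq ?_) this
      simp only [hc, hd, symp]; ring)
    (by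
      have := H.sub_mul_le t s
      refine le_trans (le_of_eq ?_) this
      simp only [hc, hd, symp]; ring)
  have g1 : 0 < g t := H.pos t
  have g2 : 0 < g s := H.pos s
  change 4 * g t * g s * (h s - h t) ≤ |n s| * h s at i1
  have i2' : 4 * g t * g s * (h t - h s) ≤ |n s| * h t := by
    have e : c s ^ 2 - (-d s) ^ 2 - 4 * symp (x s) (y s) * symp (x t) (y t) = n s := by
      simp only [hn, hg]; ring
    rw [e] at i2
    refine le_trans (le_of_eq ?_) i2
    simp only [hh, hg]; ring
  have p1 := mul_nonneg (abs_nonneg (n s)) (hpos s).le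
  have p2 := mul_nonneg (abs_nonneg (n s)) (hpos t).le
  have p3 : 0 < (h s + h t) / (4 * g t * g s) := by
    have := hpos s; have := hpos t
    positivity
  rw [one_mul, Real.norm_eq_abs, Real.norm_eq_abs, abs_mul, abs_of_pos p3, mul_div_assoc',
    le_div_iff₀ (by positivity)]
  rcases abs_cases (h s - h t) with ⟨e, _⟩ | ⟨e, _⟩ <;> rw [e] <;> nlinarith

variable {γ : ℝ}

/-- Neither of `symp (x s) (y t)` and `symp (x t) (y s)` exceeds `γ`, and their deficits add up to
the area of the two increments, so each deficit is of second order. -/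
theorem isBigO_symp_sub_left (H : OrthCurve N x y) (hγ : ∀ t, symp (x t) (y t) = γ)
    (t : ℝ) :
    (fun s => symp (x s) (y t) - γ) =O[𝓝 t] fun s => (s - t) * (s - t) := by
  refine IsBigO.trans (IsBigO.of_bound 1 (Eventually.of_forall fun s => ?_))
    (H.isBigO_symp_increments t)
  have e : symp (x s - x t) (y s - y t) = 2 * γ - symp (x s) (y t) - symp (x t) (y s) := by
    rw [two_mul]; nth_rewrite 1 [← hγ s]; rw [← hγ t]; simp [symp]; ring
  have h1 := H.symp_le s t
  have h2 := H.symp_le t s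
  rw [hγ] at h1 h2
  rw [one_mul, Real.norm_eq_abs, Real.norm_eq_abs, e, abs_of_nonpos (by linarith), abs_of_nonneg (by linarith)]
  linarith

theorem isBigO_symp_sub_right (H : OrthCurve N x y) (hγ : ∀ t, symp (x t) (y t) = γ)
    (t : ℝ) :
    (fun s => symp (x t) (y s) - γ) =O[𝓝 t] fun s => (s - t) * (s - t) := by
  refine IsBigO.trans (IsBigO.of_bound 1 (Eventually.of_forall fun s => ?_))
    (H.isBigO_symp_increments t)
  have e : symp (x s - x t) (y s - y t) = 2 * γ - symp (x s) (y t) - symp (x t) (y s) := by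
    rw [two_mul]; nth_rewrite 1 [← hγ s]; rw [← hγ t]; simp [symp]; ring
  have h1 := H.symp_le s t
  have h2 := H.symp_le t s
  rw [hγ] at h1 h2
  rw [one_mul, Real.norm_eq_abs, Real.norm_eq_abs, e, abs_of_nonpos (by linarith), abs_of_nonneg (by linarith)]
  linarith

/-- If both diagonals have constant length, then `z ↦ ω(x, z)² + ω(y, z)²` does not depend on the
point of the curve. -/
theorem symp_sq_add_symp_sq_const (H : OrthCurve N x y) (hγ : ∀ t, symp (x t) (y t) = γ)
    {a : ℝ} (ha : 0 < a) (h1 : ∀ t, N (x t + y t) = a)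
    (h2 : ∀ t, N (y t - x t) = a) (z : ℂ) (s t : ℝ) :
    symp (x s) z ^ 2 + symp (y s) z ^ 2 = symp (x t) z ^ 2 + symp (y t) z ^ 2 := by
  have hγ0 : 0 < γ := hγ 0 ▸ H.pos 0
  refine eq_of_forall_isLittleO (f := fun t => symp (x t) z ^ 2 + symp (y t) z ^ 2)
    (fun t => ?_) s t
  have oL := H.isBigO_symp_sub_left hγ t
  have oR := H.isBigO_symp_sub_right hγ t
  -- With constant diagonals the two supporting inequalities read `c ± δ ≤ 2 * γ`, so `|δ|` is at
  -- most the sum of the two deficits.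
  have oδ : (fun s => symp (x t) (x s) - symp (y t) (y s)) =O[𝓝 t] fun s => (s - t) * (s - t) := by
    refine IsBigO.trans (IsBigO.of_bound 1 (Eventually.of_forall fun s => ?_)) (oL.add oR)
    have i1 := H.add_mul_le s t
    have i2 := H.sub_mul_le s t
    rw [h1, h1, mul_comm (2 * symp (x t) (y t)), hγ] at i1
    rw [h2, h2, mul_comm (2 * symp (x t) (y t)), hγ] at i2
    have i1 := le_of_mul_le_mul_left i1 ha
    have i2 := le_of_mul_le_mul_left i2 ha
    have j1 := H.symp_le s t
    have j2 := H.symp_le t s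
    rw [hγ] at j1 j2
    rw [one_mul, Real.norm_eq_abs, Real.norm_eq_abs, abs_le]
    rw [abs_of_nonpos (by linarith : symp (x s) (y t) - γ + (symp (x t) (y s) - γ) ≤ 0)]
    constructor <;> linarith
  have ox := (H.lip_left t).isBigO_symp_sub z
  have oy := (H.lip_right t).isBigO_symp_sub z
  -- This is `γ` times the increment, after expanding the increments of `x` and `y` in the basis `x
  -- t`, `y t`.
  have tot := ((((oL.const_mul_left (2 * symp (x t) z ^ 2)).add
    (oδ.const_mul_left (2 * symp (x t) z * symp (y t) z))).add
    (oR.const_mul_left (2 * symp (y t) z ^ 2))).add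
    ((ox.mul ox).const_mul_left γ)).add ((oy.mul oy).const_mul_left γ)
  have tot' := tot.const_mul_left γ⁻¹
  refine (tot'.congr_left fun s => ?_).trans_isLittleO (isLittleO_sub_mul_sub t)
  rw [inv_mul_eq_iff_eq_mul₀ hγ0.ne']
  rw [← hγ t]; simp only [symp, Complex.sub_re, Complex.sub_im]; ring

end OrthCurve

/-! ### Unit vectors by angle and sector area. -/

/-- The unit vector, with respect to `N`, at angle `θ`. -/
noncomputable def unitDir (N : Seminorm ℝ ℂ) (θ : ℝ) : ℂ := (N (dir θ))⁻¹ • dir θ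

/-- Twice the area of the sector of the unit disc of `N` between the angles `0` and `θ`. -/
noncomputable def sectorArea (N : Seminorm ℝ ℂ) (θ : ℝ) : ℝ := ∫ φ in (0 : ℝ)..θ, (N (dir φ) ^ 2)⁻¹

theorem hasDerivAt_dir (θ : ℝ) : HasDerivAt dir (dir θ * Complex.I) θ := by
  have h1 : HasDerivAt (fun θ : ℝ => (θ : ℂ) * Complex.I) Complex.I θ := by
    simpa using (Complex.ofRealCLM.hasDerivAt (x := θ)).mul_const Complex.I
  have h2 := h1.cexp
  rw [← dir_eq_exp] at h2
  exact h2.congr_of_eventuallyEq (Eventually.of_forall dir_eq_exp)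

theorem dir_continuous : Continuous dir :=
  continuous_iff_continuousAt.2 fun θ => (hasDerivAt_dir θ).continuousAt

theorem LipAt.dir {θ : ℝ → ℝ} {t : ℝ} (h : LipAt θ t) : LipAt (fun s => dir (θ s)) t :=
  LipAt.comp_hasFDerivAt (hasDerivAt_dir _).hasFDerivAt h

theorem LipAt.arg {w : ℝ → ℂ} {t : ℝ} (h : LipAt w t) (hw : 0 < (w t).im) :
    LipAt (fun s => Complex.arg (w s)) t := by
  have h1 := LipAt.comp_hasFDerivAt
    ((Complex.hasStrictDerivAt_log (x := w t) (Or.inr hw.ne')).hasDerivAt.hasFDerivAt.restrictScalars ℝ) h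
  refine IsBigO.trans (IsBigO.of_bound 1 (Eventually.of_forall fun s => ?_)) h1
  have := Complex.abs_im_le_norm (Complex.log (w s) - Complex.log (w t))
  simpa [Complex.log_im] using this

theorem arg_mem_Ioo_of_im_pos {w : ℂ} (hw : 0 < w.im) :
    0 < Complex.arg w ∧ Complex.arg w < Real.pi := by
  have h0 : w ≠ 0 := by rintro rfl; simp at hw
  have hs : 0 < Real.sin (Complex.arg w) := by
    rw [Complex.sin_arg]; exact div_pos hw (norm_pos_iff.2 h0)
  constructor
  · by_contra! h
    have := Real.sin_nonpos_of_nonpos_of_neg_pi_le h (Complex.neg_pi_lt_arg w).le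
    linarith
  · refine lt_of_le_of_ne (Complex.arg_le_pi w) fun h => ?_
    rw [h, Real.sin_pi] at hs
    exact lt_irrefl _ hs

theorem symp_unitDir (N : Seminorm ℝ ℂ) (α β : ℝ) :
    symp (unitDir N α) (unitDir N β) = (N (dir α))⁻¹ * ((N (dir β))⁻¹ * Real.sin (β - α)) := by
  rw [unitDir, unitDir, symp_smul_left, symp_smul_right, symp_dir]

section

variable {N : Seminorm ℝ ℂ}

theorem seminorm_unitDir (hN : ∀ z, z ≠ 0 → 0 < N z)
    (θ : ℝ) : N (unitDir N θ) = 1 := by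
  have := hN _ (dir_ne_zero θ)
  rw [unitDir, seminorm_smul, abs_of_pos (inv_pos.2 this), inv_mul_cancel₀ this.ne']

theorem unitDir_eq (hN : ∀ z, z ≠ 0 → 0 < N z)
    {r θ : ℝ} (hr : 0 < r) {z : ℂ} (hz : z = r • dir θ) :
    unitDir N θ = (N z)⁻¹ • z := by
  have := hN _ (dir_ne_zero θ)
  rw [hz, seminorm_smul, abs_of_pos hr, unitDir, smul_smul]
  congr 1
  field_simp

theorem LipAt.unitDir (hN : ∀ z, z ≠ 0 → 0 < N z)
    {θ : ℝ → ℝ} {t : ℝ} (h : LipAt θ t) :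
    LipAt (fun s => unitDir N (θ s)) t :=
  ((h.dir.seminorm N).inv (hN _ (dir_ne_zero _)).ne').smul h.dir

theorem continuous_sectorDensity (hN : ∀ z, z ≠ 0 → 0 < N z)
    : Continuous fun φ => (N (dir φ) ^ 2)⁻¹ := by
  have := (seminorm_continuous N).comp dir_continuous
  exact (this.pow 2).inv₀ fun φ => (pow_pos (hN _ (dir_ne_zero φ)) 2).ne'

theorem hasDerivAt_sectorArea (hN : ∀ z, z ≠ 0 → 0 < N z)
    (θ : ℝ) :
    HasDerivAt (sectorArea N) (N (dir θ) ^ 2)⁻¹ θ := by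
  have h := continuous_sectorDensity hN
  exact intervalIntegral.integral_hasDerivAt_right (h.intervalIntegrable _ _)
    h.aestronglyMeasurable.stronglyMeasurableAtFilter h.continuousAt

theorem sectorArea_add_pi (hN : ∀ z, z ≠ 0 → 0 < N z)
    (θ : ℝ) :
    sectorArea N (θ + Real.pi) = sectorArea N θ + sectorArea N Real.pi := by
  have h := continuous_sectorDensity hN
  have hp : Function.Periodic (fun φ => (N (dir φ) ^ 2)⁻¹) Real.pi := by
    intro φ; simp only [dir_add_pi, map_neg_eq_map]
  have e := hp.intervalIntegral_add_eq θ 0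
  rw [zero_add] at e
  rw [sectorArea, sectorArea, sectorArea, ← e,
    intervalIntegral.integral_add_adjacent_intervals (h.intervalIntegrable _ _)
      (h.intervalIntegrable _ _)]

theorem exists_sectorArea_sub_ge (hN : ∀ z, z ≠ 0 → 0 < N z)
    :
    ∃ c > 0, ∀ θ φ, θ ≤ φ → c * (φ - θ) ≤ sectorArea N φ - sectorArea N θ := by
  set C := N 1 + N Complex.I with hC
  have hC0 : 0 < C := add_pos_of_pos_of_nonneg (hN 1 one_ne_zero) (apply_nonneg N _)
  have hd : ∀ θ, HasDerivAt (fun θ => sectorArea N θ - (C ^ 2)⁻¹ * θ)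
      ((N (dir θ) ^ 2)⁻¹ - (C ^ 2)⁻¹ * 1) θ := fun θ =>
    (hasDerivAt_sectorArea hN θ).sub ((hasDerivAt_id θ).const_mul _)
  have hm : Monotone fun θ => sectorArea N θ - (C ^ 2)⁻¹ * θ := by
    apply monotone_of_deriv_nonneg fun θ => (hd θ).differentiableAt
    intro θ
    rw [(hd θ).deriv, mul_one, sub_nonneg]
    have h1 := seminorm_le_mul_norm N (dir θ)
    rw [norm_dir, mul_one] at h1
    have h2 := hN _ (dir_ne_zero θ)
    gcongr
  refine ⟨(C ^ 2)⁻¹, by positivity, fun θ φ h => ?_⟩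
  have := hm h
  simp only at this
  linarith

/-- To first order a thin sector has the area of the triangle spanned by its two bounding unit
vectors. -/
theorem sectorArea_sub_isLittleO (hN : ∀ z, z ≠ 0 → 0 < N z)
    {θ : ℝ → ℝ} {t : ℝ} (h : LipAt θ t) :
    (fun s => sectorArea N (θ s) - sectorArea N (θ t) -
      symp (unitDir N (θ t)) (unitDir N (θ s))) =o[𝓝 t] fun s => s - t := by
  have h1 := (hasDerivAt_iff_isLittleO.1 (hasDerivAt_sectorArea hN (θ t))).comp_tendsto
    h.continuousAt
  have h1' := h1.trans_isBigO h
  have h2 : LipAt (fun s => unitDir N (θ s)) t := LipAt.unitDir hN h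
  have hs : HasDerivAt (fun φ => Real.sin (φ - θ t)) 1 (θ t) := by
    have := ((hasDerivAt_id (θ t)).sub_const (θ t)).sin
    simpa using this
  have h3 := ((hasDerivAt_iff_isLittleO.1 hs).comp_tendsto h.continuousAt).trans_isBigO h
  have h4 := ((h.dir.seminorm N).inv (hN _ (dir_ne_zero _)).ne')
  have h5 : (fun s => Real.sin (θ s - θ t)) =O[𝓝 t] fun s => s - t := by
    have := (LipAt.comp_hasFDerivAt hs.hasFDerivAt h)
    simpa [LipAt] using this
  have h6 := (h4.mul h5).trans_isLittleO (isLittleO_sub_mul_sub t)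
  have tot := (h1'.sub (h3.const_mul_left ((N (dir (θ t)) ^ 2)⁻¹))).sub
    (h6.const_mul_left (N (dir (θ t)))⁻¹)
  refine tot.congr_left fun s => ?_
  rw [symp_unitDir]
  have := (hN _ (dir_ne_zero (θ t))).ne'
  simp only [Function.comp, smul_eq_mul, sub_self, Real.sin_zero, sub_zero, mul_one]
  field_simp
  ring

end

/-! ### The parametrized curve and the Euclidean structure of the plane. -/

/-- `OrthAngles` pairs parametrized by the sum of the two angles. -/
structure AngleParam (N : Seminorm ℝ ℂ) (α β : ℝ → ℝ) : Prop where
  angles : ∀ t, OrthAngles N (α t) (β t)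
  add_eq : ∀ t, α t + β t = t

theorem exists_angleParam {N : Seminorm ℝ ℂ} (hN : ∀ z, z ≠ 0 → 0 < N z) :
    ∃ α β, AngleParam N α β := by
  choose α β h using exists_orthAngles hN
  exact ⟨α, β, fun t => (h t).1, fun t => (h t).2⟩

namespace AngleParam

variable {N : Seminorm ℝ ℂ} {α β : ℝ → ℝ}

theorem lt_left (P : AngleParam N α β)
    (t : ℝ) : (t - Real.pi) / 2 < α t := by
  have := (P.angles t).lt_add_pi; have := P.add_eq t; linarith

theorem left_lt (P : AngleParam N α β)
    (t : ℝ) : α t < t / 2 := by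
  have := (P.angles t).lt; have := P.add_eq t; linarith

theorem mono (P : AngleParam N α β) (hN : ∀ z, z ≠ 0 → 0 < N z)
    {s t : ℝ} (h : s ≤ t) : α s ≤ α t ∧ β s ≤ β t :=
  (P.angles s).le_of_add_le hN (P.angles t) (by rw [P.add_eq, P.add_eq]; exact h)

theorem lip_left (P : AngleParam N α β) (hN : ∀ z, z ≠ 0 → 0 < N z)
    (t : ℝ) : LipAt α t := by
  refine IsBigO.of_bound 1 (Eventually.of_forall fun s => ?_)
  have a1 := P.add_eq s; have a2 := P.add_eq t
  rw [one_mul, Real.norm_eq_abs, Real.norm_eq_abs]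
  rcases le_total s t with h | h
  · have := P.mono hN h
    rw [abs_of_nonpos (by linarith), abs_of_nonpos (by linarith)]; linarith
  · have := P.mono hN h
    rw [abs_of_nonneg (by linarith), abs_of_nonneg (by linarith)]; linarith

theorem lip_right (P : AngleParam N α β) (hN : ∀ z, z ≠ 0 → 0 < N z)
    (t : ℝ) : LipAt β t := by
  have h : LipAt (fun s : ℝ => s) t := isBigO_refl _ _
  have e : β = fun s => s - α s := funext fun s => by linarith [P.add_eq s]
  rw [e]; exact h.sub (P.lip_left hN t)

theorem eq_of_orthAngles (P : AngleParam N α β) (hN : ∀ z, z ≠ 0 → 0 < N z)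
    {φ χ : ℝ} (h : OrthAngles N φ χ) : α (φ + χ) = φ ∧ β (φ + χ) = χ :=
  (P.angles _).unique hN h (P.add_eq _)

theorem add_two_pi (P : AngleParam N α β) (hN : ∀ z, z ≠ 0 → 0 < N z)
    (t : ℝ) : α (t + 2 * Real.pi) = α t + Real.pi ∧
    β (t + 2 * Real.pi) = β t + Real.pi := by
  have h : OrthAngles N (α t + Real.pi) (β t + Real.pi) := by
    have h := P.angles t
    refine ⟨by linarith [h.lt], by linarith [h.lt_add_pi], ?_⟩
    rw [dir_add_pi, dir_add_pi]
    simpa using h.orth.smul (-1) (-1)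
  have := P.eq_of_orthAngles hN h
  rwa [show α t + Real.pi + (β t + Real.pi) = t + 2 * Real.pi by linarith [P.add_eq t]] at this

theorem surjective_left (P : AngleParam N α β) (hN : ∀ z, z ≠ 0 → 0 < N z)
    : Function.Surjective α := by
  refine Continuous.surjective
    (continuous_iff_continuousAt.2 fun t => (P.lip_left hN t).continuousAt) ?_ ?_
  · refine tendsto_atTop_mono (fun t => (P.lt_left t).le) ?_
    exact (tendsto_atTop_add_const_right _ (-Real.pi) tendsto_id).atTop_div_const two_pos
  · refine tendsto_atBot_mono (fun t => (P.left_lt t).le) ?_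
    exact tendsto_id.atBot_div_const two_pos

/-- Orthogonality is not known to be symmetric; the two relations between the diagonals come from
`hD` applied to `(x, y)` and to `(x, -y)`. -/
theorem orthCurve (P : AngleParam N α β) (hN : ∀ z, z ≠ 0 → 0 < N z)
    (hD : ∀ x y, N x = 1 → N y = 1 → SeminormOrth N x y → SeminormOrth N (x - y) (x + y))
    : OrthCurve N (fun t => unitDir N (α t)) (fun t => unitDir N (β t)) := by
  have ho : ∀ t, SeminormOrth N (unitDir N (α t)) (unitDir N (β t)) := fun t =>
    (P.angles t).orth.smul _ _
  refine ⟨fun t => seminorm_unitDir hN _, fun t => seminorm_unitDir hN _, fun t => ?_, ho,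
    fun t => ?_, fun t => ?_, fun t => LipAt.unitDir hN (P.lip_left hN t),
    fun t => LipAt.unitDir hN (P.lip_right hN t)⟩
  · rw [symp_unitDir]
    have h := P.angles t
    have := hN _ (dir_ne_zero (α t))
    have := hN _ (dir_ne_zero (β t))
    have := Real.sin_pos_of_pos_of_lt_pi (sub_pos.2 h.lt) (by linarith [h.lt_add_pi])
    positivity
  · have h1 : SeminormOrth N (unitDir N (α t)) (-unitDir N (β t)) := by
      simpa using (ho t).smul 1 (-1)
    have h2 := hD _ _ (seminorm_unitDir hN _) (by rw [map_neg_eq_map, seminorm_unitDir hN]) h1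
    have h3 := h2.smul 1 (-1)
    rwa [one_smul, neg_one_smul, sub_neg_eq_add, neg_add, neg_neg, neg_add_eq_sub] at h3
  · have h2 := hD _ _ (seminorm_unitDir hN _) (seminorm_unitDir hN _) (ho t)
    have h3 := h2.smul (-1) 1
    rwa [one_smul, neg_one_smul, neg_sub] at h3

/-- The diagonals `x + y` and `y - x` point at a pair of orthogonal angles `φ, χ`, chosen
continuously along the curve. -/
theorem exists_diagonal_angles (P : AngleParam N α β) (hN : ∀ z, z ≠ 0 → 0 < N z)
    (hD : ∀ x y, N x = 1 → N y = 1 → SeminormOrth N x y → SeminormOrth N (x - y) (x + y))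
    : ∃ φ χ : ℝ → ℝ,
    (∀ t, OrthAngles N (φ t) (χ t)) ∧ (∀ t, LipAt φ t) ∧ (∀ t, LipAt χ t) ∧
    (∀ t, unitDir N (φ t) = (N (unitDir N (α t) + unitDir N (β t)))⁻¹ •
      (unitDir N (α t) + unitDir N (β t))) ∧
    (∀ t, unitDir N (χ t) = (N (unitDir N (β t) - unitDir N (α t)))⁻¹ •
      (unitDir N (β t) - unitDir N (α t))) ∧
    (∀ t, φ (t + 2 * Real.pi) = φ t + Real.pi) ∧ (∀ t, χ (t + 2 * Real.pi) = χ t + Real.pi) ∧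
    (∀ t, α t < φ t ∧ χ t < α t + Real.pi) := by
  have H := P.orthCurve hN hD
  -- The diagonals rotated by `-α t`. Both then lie in the open upper half-plane, away from the
  -- branch cut of `Complex.arg`.
  set p : ℝ → ℂ := fun t =>
    (N (dir (α t)))⁻¹ • (1 : ℂ) + (N (dir (β t)))⁻¹ • dir (β t - α t) with hp
  set q : ℝ → ℂ := fun t =>
    (N (dir (β t)))⁻¹ • dir (β t - α t) - (N (dir (α t)))⁻¹ • (1 : ℂ) with hq
  have mul_dir : ∀ t, dir (α t) * dir (β t - α t) = dir (β t) := fun t => by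
    rw [← dir_add]; congr 1; ring
  have pe : ∀ t, unitDir N (α t) + unitDir N (β t) = dir (α t) * p t := fun t => by
    simp only [hp, unitDir, mul_add, mul_smul_comm, mul_one, mul_dir]
  have qe : ∀ t, unitDir N (β t) - unitDir N (α t) = dir (α t) * q t := fun t => by
    simp only [hq, unitDir, mul_sub, mul_smul_comm, mul_one, mul_dir]
  have sinpos : ∀ t, 0 < (N (dir (β t)))⁻¹ * Real.sin (β t - α t) := fun t => by
    have h := P.angles t
    have := hN _ (dir_ne_zero (β t))
    have := Real.sin_pos_of_pos_of_lt_pi (sub_pos.2 h.lt) (by linarith [h.lt_add_pi])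
    positivity
  have pim : ∀ t, 0 < (p t).im := fun t => by
    have : (p t).im = (N (dir (β t)))⁻¹ * Real.sin (β t - α t) := by simp [hp, dir]
    rw [this]; exact sinpos t
  have qim : ∀ t, 0 < (q t).im := fun t => by
    have : (q t).im = (N (dir (β t)))⁻¹ * Real.sin (β t - α t) := by simp [hq, dir]
    rw [this]; exact sinpos t
  have lα := P.lip_left hN
  have lβ := P.lip_right hN
  have l1 : ∀ t, LipAt (fun s => (N (dir (α s)))⁻¹ • (1 : ℂ)) t := fun t =>
    (((lα t).dir.seminorm N).inv (hN _ (dir_ne_zero _)).ne').smul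
      (by simp [LipAt, isBigO_zero])
  have l2 : ∀ t, LipAt (fun s => (N (dir (β s)))⁻¹ • dir (β s - α s)) t := fun t =>
    (((lβ t).dir.seminorm N).inv (hN _ (dir_ne_zero _)).ne').smul ((lβ t).sub (lα t)).dir
  have pz : ∀ t, unitDir N (α t) + unitDir N (β t) = ‖p t‖ • dir (α t + Complex.arg (p t)) :=
    fun t => by rw [pe, dir_add, ← mul_smul_comm, norm_smul_dir_arg]
  have qz : ∀ t, unitDir N (β t) - unitDir N (α t) = ‖q t‖ • dir (α t + Complex.arg (q t)) :=
    fun t => by rw [qe, dir_add, ← mul_smul_comm, norm_smul_dir_arg]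
  have pn : ∀ t, 0 < ‖p t‖ := fun t => norm_pos_iff.2 fun h => by
    have := pim t; rw [h] at this; simp at this
  have qn : ∀ t, 0 < ‖q t‖ := fun t => norm_pos_iff.2 fun h => by
    have := qim t; rw [h] at this; simp at this
  have per : ∀ t, p (t + 2 * Real.pi) = p t ∧ q (t + 2 * Real.pi) = q t := fun t => by
    simp only [hp, hq, (P.add_two_pi hN t).1, (P.add_two_pi hN t).2, dir_add_pi, map_neg_eq_map,
      add_sub_add_right_eq_sub, and_self]
  refine ⟨fun t => α t + Complex.arg (p t), fun t => α t + Complex.arg (q t), fun t => ?_,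
    fun t => (lα t).add (LipAt.arg ((l1 t).add (l2 t)) (pim t)),
    fun t => (lα t).add (LipAt.arg ((l2 t).sub (l1 t)) (qim t)),
    fun t => unitDir_eq hN (pn t) (pz t), fun t => unitDir_eq hN (qn t) (qz t),
    fun t => ?_, fun t => ?_, fun t => ?_⟩
  · have b1 := arg_mem_Ioo_of_im_pos (pim t)
    have b2 := arg_mem_Ioo_of_im_pos (qim t)
    have s1 : 0 < Real.sin (α t + Complex.arg (q t) - (α t + Complex.arg (p t))) := by
      have h1 := symp_add_sub (unitDir N (α t)) (unitDir N (β t))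
      have h2 := H.pos t
      rw [pz, qz, symp_smul_left, symp_smul_right, symp_dir, ← mul_assoc] at h1
      refine (pos_iff_pos_of_mul_pos ?_).1 (mul_pos (pn t) (qn t))
      rw [h1]; linarith
    refine ⟨?_, by linarith, ?_⟩
    · by_contra! h
      have := Real.sin_nonpos_of_nonpos_of_neg_pi_le (sub_nonpos.2 h) (by linarith)
      linarith
    · have h1 := (H.add_orth t).smul ‖p t‖⁻¹ ‖q t‖⁻¹
      simp only [pz, qz] at h1
      rwa [inv_smul_smul₀ (pn t).ne', inv_smul_smul₀ (qn t).ne'] at h1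
  · simp only [(per t).1, (P.add_two_pi hN t).1]; ring
  · simp only [(per t).2, (P.add_two_pi hN t).1]; ring
  · have b1 := arg_mem_Ioo_of_im_pos (pim t)
    have b2 := arg_mem_Ioo_of_im_pos (qim t)
    exact ⟨by linarith, by linarith⟩

theorem parallelogram (P : AngleParam N α β) (hN : ∀ z, z ≠ 0 → 0 < N z)
    (hD : ∀ x y, N x = 1 → N y = 1 → SeminormOrth N x y → SeminormOrth N (x - y) (x + y))
    (z w : ℂ) :
    N (z + w) ^ 2 + N (z - w) ^ 2 = 2 * (N z ^ 2 + N w ^ 2) := by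
  have H := P.orthCurve hN hD
  obtain ⟨φ, χ, hang, lφ, lχ, hφ, hχ, pφ, pχ, hb⟩ := P.exists_diagonal_angles hN hD
  set x : ℝ → ℂ := fun t => unitDir N (α t) with hx
  set y : ℝ → ℂ := fun t => unitDir N (β t) with hy
  have apos : ∀ t, 0 < N (x t + y t) := fun t => hN _ fun h => by
    have := symp_add_sub (x t) (y t); rw [h] at this
    have h2 := H.pos t
    simp [symp] at this h2; linarith
  have bpos : ∀ t, 0 < N (y t - x t) := fun t => hN _ fun h => by
    have := symp_add_sub (x t) (y t); rw [h] at this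
    have h2 := H.pos t
    simp [symp] at this h2; linarith
  have hτ : Function.Surjective fun t => φ t + χ t := by
    refine Continuous.surjective (continuous_iff_continuousAt.2 fun t =>
      ((lφ t).add (lχ t)).continuousAt) ?_ ?_
    · refine tendsto_atTop_mono (fun t => ?_)
        (tendsto_atTop_add_const_right _ (-Real.pi) tendsto_id)
      have := P.lt_left t; have := hb t; have := (hang t).lt
      simp only [id]; linarith
    · refine tendsto_atBot_mono (fun t => ?_)
        (tendsto_atBot_add_const_right _ (2 * Real.pi) tendsto_id)
      have := P.left_lt t; have := hb t; have := (hang t).lt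
      simp only [id]; linarith
  -- At parameter `φ t + χ t` the curve passes through the normalized diagonals of parameter `t`,
  -- whose area is twice the constant ratio. These parameters exhaust the line.
  obtain ⟨γ, hγ⟩ : ∃ γ, ∀ t, symp (x t) (y t) = γ := by
    refine ⟨2 * (symp (x 0) (y 0) / (N (x 0 + y 0) * N (y 0 - x 0))), fun t' => ?_⟩
    obtain ⟨t, rfl⟩ := hτ t'
    have e := P.eq_of_orthAngles hN (hang t)
    simp only [hx, hy, e.1, e.2]
    rw [hφ, hχ, symp_smul_left, symp_smul_right, symp_add_sub, H.symp_ratio_const hN 0 t]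
    change (N (x t + y t))⁻¹ * ((N (y t - x t))⁻¹ * (2 * symp (x t) (y t))) = _
    have := (apos t).ne'
    have := (bpos t).ne'
    field_simp
  have hγ0 : 0 < γ := hγ 0 ▸ H.pos 0
  have hab : ∀ t, N (x t + y t) * N (y t - x t) = 2 := fun t => by
    have e := P.eq_of_orthAngles hN (hang t)
    have h1 := hγ (φ t + χ t)
    simp only [hx, hy, e.1, e.2] at h1
    rw [hφ, hχ, symp_smul_left, symp_smul_right, symp_add_sub] at h1
    change (N (x t + y t))⁻¹ * ((N (y t - x t))⁻¹ * (2 * symp (x t) (y t))) = γ at h1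
    rw [hγ] at h1
    have := (apos t).ne'
    have := (bpos t).ne'
    field_simp at h1
    linarith
  set A : ℝ → ℝ := fun t => (N (x t + y t))⁻¹ with hA
  set B : ℝ → ℝ := fun t => (N (y t - x t))⁻¹ with hB
  have hAB : ∀ t, A t * B t = 1 / 2 := fun t => by
    simp only [hA, hB]; rw [← mul_inv, hab]; norm_num
  set F := sectorArea N with hF
  set S : ℝ → ℝ := fun t => F (α t) + F (β t) with hS
  set Φ : ℝ → ℝ := fun t => F (φ t) + F (χ t) - S t with hΦ
  -- To first order the diagonals sweep `A ^ 2 + B ^ 2` times the area swept by the sides: the mixed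
  -- terms are of second order. As `2 * A * B = 1`, subtracting `S` leaves the factor `(A - B) ^ 2`.
  have key : ∀ t, (fun s => Φ s - Φ t - (A t - B t) ^ 2 * (S s - S t)) =o[𝓝 t] fun s => s - t := by
    intro t
    have d1 := sectorArea_sub_isLittleO hN (P.lip_left hN t)
    have d2 := sectorArea_sub_isLittleO hN (P.lip_right hN t)
    have d3 := sectorArea_sub_isLittleO hN (lφ t)
    have d4 := sectorArea_sub_isLittleO hN (lχ t)
    have oσ : (fun s => symp (x t) (x s) + symp (y t) (y s)) =O[𝓝 t] fun s => s - t :=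
      (H.isBigO_symp_left t).add (H.isBigO_symp_right t)
    have oε := (H.isBigO_symp_sub_right hγ t).sub (H.isBigO_symp_sub_left hγ t)
    have lA : LipAt A t := (((H.lip_left t).add (H.lip_right t)).seminorm N).inv (apos t).ne'
    have lB : LipAt B t := (((H.lip_right t).sub (H.lip_left t)).seminorm N).inv (bpos t).ne'
    have e1 := ((lA.mul oσ).const_mul_left (A t)).trans_isLittleO (isLittleO_sub_mul_sub t)
    have e2 := ((lB.mul oσ).const_mul_left (B t)).trans_isLittleO (isLittleO_sub_mul_sub t)
    have e3 := (oε.mul (lA.continuousAt.tendsto.isBigO_one ℝ)).const_mul_left (A t)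
    have e4 := (oε.mul (lB.continuousAt.tendsto.isBigO_one ℝ)).const_mul_left (B t)
    simp only [mul_one] at e3 e4
    have e3 := e3.trans_isLittleO (isLittleO_sub_mul_sub t)
    have e4 := e4.trans_isLittleO (isLittleO_sub_mul_sub t)
    have tot := (((d3.add d4).add (e1.add e2)).add (e3.sub e4)).sub
      ((d1.add d2).const_mul_left (A t ^ 2 + B t ^ 2))
    refine tot.congr_left fun s => ?_
    have f1 : symp (unitDir N (φ t)) (unitDir N (φ s)) = A t * A s *
        (symp (x t) (x s) + symp (y t) (y s) + (symp (x t) (y s) - symp (x s) (y t))) := by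
      rw [hφ, hφ, symp_smul_left, symp_smul_right]; simp only [hA, symp]; simp; ring
    have f2 : symp (unitDir N (χ t)) (unitDir N (χ s)) = B t * B s *
        (symp (x t) (x s) + symp (y t) (y s) - (symp (x t) (y s) - symp (x s) (y t))) := by
      rw [hχ, hχ, symp_smul_left, symp_smul_right]; simp only [hB, symp]; simp; ring
    rw [f1, f2]
    have hk : (A t - B t) ^ 2 = A t ^ 2 + B t ^ 2 - 1 := by
      have := hAB t; linear_combination (-2) * this
    rw [hk]
    simp only [hΦ, hS]
    ring
  obtain ⟨c, hc0, hc⟩ := exists_sectorArea_sub_ge hN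
  have Sge : ∀ s t, s ≤ t → c * (t - s) ≤ S t - S s := fun s t h => by
    have h1 := hc _ _ (P.mono hN h).1
    have h2 := hc _ _ (P.mono hN h).2
    have := P.add_eq s; have := P.add_eq t
    simp only [hS, hF]
    calc c * (t - s) = c * (α t - α s) + c * (β t - β s) := by rw [← mul_add]; congr 1; linarith
      _ ≤ _ := by linarith
  have Smono : Monotone S := fun s t h => by
    have := Sge s t h
    have := mul_nonneg hc0.le (sub_nonneg.2 h)
    linarith
  have Fc : Continuous F :=
    continuous_iff_continuousAt.2 fun θ => (hasDerivAt_sectorArea hN θ).continuousAt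
  have cont : ∀ {f : ℝ → ℝ}, (∀ t, LipAt f t) → Continuous f := fun h =>
    continuous_iff_continuousAt.2 fun t => (h t).continuousAt
  have Φc : Continuous Φ := ((Fc.comp (cont lφ)).add (Fc.comp (cont lχ))).sub
    ((Fc.comp (cont (P.lip_left hN))).add (Fc.comp (cont (P.lip_right hN))))
  have Φm : Monotone Φ := monotone_of_isLittleO Φc Smono (fun t => sq_nonneg _) key
  have Φp : ∀ t, Φ (t + 2 * Real.pi) = Φ t := fun t => by
    simp only [hΦ, hS, hF, pφ, pχ, (P.add_two_pi hN t).1, (P.add_two_pi hN t).2,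
      sectorArea_add_pi hN]
    ring
  -- `Φ` is monotone and periodic, hence constant, while `S` grows at least linearly; a nonzero
  -- factor would make `Φ` increase.
  have hABeq : ∀ t, A t = B t := by
    intro t
    have ev : ∀ᶠ s in 𝓝[>] t, s ∈ Set.Ioo t (t + 2 * Real.pi) :=
      Ioo_mem_nhdsGT (by linarith [Real.pi_pos])
    by_contra hne
    have hk : 0 < (A t - B t) ^ 2 := by
      have := sub_ne_zero.2 hne
      positivity
    have h1 := (key t).def (half_pos (mul_pos hk hc0))
    obtain ⟨s, hs, hs2⟩ := ((h1.filter_mono nhdsWithin_le_nhds).and ev).exists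
    have m1 := Φm hs2.1.le
    have m2 := Φm hs2.2.le
    rw [Φp] at m2
    have e : Φ s - Φ t = 0 := by linarith
    have h3 := mul_le_mul_of_nonneg_left (Sge t s hs2.1.le) hk.le
    have hst : 0 < s - t := sub_pos.2 hs2.1
    rw [e, zero_sub, norm_neg, Real.norm_eq_abs, Real.norm_eq_abs, abs_of_pos hst] at hs
    have h4 := (le_abs_self _).trans hs
    have h5 := mul_pos (mul_pos hk hc0) hst
    linarith
  have hsqrt : ∀ t, N (x t + y t) = √2 ∧ N (y t - x t) = √2 := fun t => by
    have h1 : N (x t + y t) = N (y t - x t) := inv_injective (hABeq t)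
    have h2 := hab t
    rw [← h1] at h2
    have h3 : N (x t + y t) = √2 := by
      rw [← h2, Real.sqrt_mul_self (apos t).le]
    exact ⟨h3, h1 ▸ h3⟩
  have quad : ∀ z, N z ^ 2 * γ ^ 2 = symp (x 0) z ^ 2 + symp (y 0) z ^ 2 := by
    intro z
    rcases eq_or_ne z 0 with rfl | hz
    · simp [symp]
    · obtain ⟨t, ht⟩ := P.surjective_left hN (Complex.arg z)
      have e1 := unitDir_eq hN (norm_pos_iff.2 hz) (norm_smul_dir_arg z).symm
      rw [← ht] at e1
      have e2 : z = N z • x t := by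
        simp only [hx]; rw [e1, smul_inv_smul₀ (hN z hz).ne']
      rw [H.symp_sq_add_symp_sq_const hγ (Real.sqrt_pos.2 two_pos) (fun t => (hsqrt t).1)
        (fun t => (hsqrt t).2) z 0 t]
      conv_rhs => rw [e2, symp_smul_right, symp_smul_right, symp_self, symp_swap (y t), hγ]
      ring
  have h0 : γ ^ 2 ≠ 0 := by positivity
  apply mul_right_cancel₀ h0
  have q1 := quad (z + w)
  have q2 := quad (z - w)
  have q3 := quad z
  have q4 := quad w
  rw [symp_add_right, symp_add_right] at q1
  rw [symp_sub_right, symp_sub_right] at q2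
  linear_combination q1 + q2 - 2 * q3 - 2 * q4

end AngleParam

/-! ### Reduction to planes, and the inequality in inner product spaces. -/

section Plane

variable {X : Type*} [NormedAddCommGroup X] [NormedSpace ℝ X]

/-- The linear parametrization of the span of `v` and `w` by the plane. -/
noncomputable def planeMap (v w : X) : ℂ →ₗ[ℝ] X :=
  Complex.reLm.smulRight v + Complex.imLm.smulRight w

theorem planeMap_apply (v w : X) (z : ℂ) : planeMap v w z = z.re • v + z.im • w := rfl

/-- The norm of `X` pulled back to the plane. -/
noncomputable def planeSeminorm (v w : X) : Seminorm ℝ ℂ :=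
  (normSeminorm ℝ X).comp (planeMap v w)

theorem planeSeminorm_apply (v w : X) (z : ℂ) : planeSeminorm v w z = ‖planeMap v w z‖ := rfl

theorem planeSeminorm_pos {v w : X} (h : LinearIndependent ℝ ![v, w]) (z : ℂ) (hz : z ≠ 0) :
    0 < planeSeminorm v w z := by
  rw [planeSeminorm_apply, norm_pos_iff, planeMap_apply]
  intro h0
  have := LinearIndependent.pair_iff.1 h _ _ h0
  exact hz (Complex.ext this.1 this.2)

/-- For `|r| < 1` the vectors `(1 + r) • x` and `(1 - r) • y` normalize to `x` and `y`, and their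
norms add up to 2, so the inequality reads `‖x - y‖ ≤ ‖x - y + r • (x + y)‖`. Convexity extends this
to every real factor. -/
theorem norm_sub_le_norm_sub_add_smul
    (h : ∀ x y : X, x ≠ 0 → y ≠ 0 → BirkhoffOrthogonal x y →
        ‖‖x‖⁻¹ • x - ‖y‖⁻¹ • y‖ ≤ 2 * ‖x - y‖ / (‖x‖ + ‖y‖))
    {x y : X} (hx : ‖x‖ = 1) (hy : ‖y‖ = 1) (hxy : BirkhoffOrthogonal x y) (s : ℝ) :
    ‖x - y‖ ≤ ‖x - y + s • (x + y)‖ := by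
  have hx0 : x ≠ 0 := by rintro rfl; simp at hx
  have hy0 : y ≠ 0 := by rintro rfl; simp at hy
  have small : ∀ r : ℝ, |r| < 1 → ‖x - y‖ ≤ ‖x - y + r • (x + y)‖ := by
    intro r hr
    have hr' := abs_lt.1 hr
    have p1 : 0 < 1 + r := by linarith
    have p2 : 0 < 1 - r := by linarith
    have ho : BirkhoffOrthogonal ((1 + r) • x) ((1 - r) • y) := by
      intro t
      have e : (1 + r) • x + t • (1 - r) • y = (1 + r) • (x + ((1 + r)⁻¹ * (t * (1 - r))) • y) := by
        rw [smul_add, smul_smul, smul_smul, ← mul_assoc, mul_inv_cancel₀ p1.ne', one_mul]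
      rw [e, norm_smul, norm_smul]
      exact mul_le_mul_of_nonneg_left (hxy _) (norm_nonneg _)
    have := h _ _ (smul_ne_zero p1.ne' hx0) (smul_ne_zero p2.ne' hy0) ho
    rw [norm_smul, norm_smul, hx, hy, Real.norm_of_nonneg p1.le, Real.norm_of_nonneg p2.le,
      mul_one, mul_one, inv_smul_smul₀ p1.ne', inv_smul_smul₀ p2.ne'] at this
    rw [show (1 + r) • x - (1 - r) • y = x - y + r • (x + y) by module,
      show 1 + r + (1 - r) = 2 by ring, mul_div_cancel_left₀ _ two_ne_zero] at this
    exact this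
  set l : ℝ := (1 + |s|)⁻¹ with hl
  have hl0 : 0 < l := by positivity
  have hl1 : l ≤ 1 := inv_le_one_of_one_le₀ (by linarith [abs_nonneg s])
  have h1 := small (l * s) (by
    rw [abs_mul, abs_of_pos hl0, hl, inv_mul_lt_iff₀ (by positivity)]; linarith)
  have h2 : ‖x - y + (l * s) • (x + y)‖ ≤ (1 - l) * ‖x - y‖ + l * ‖x - y + s • (x + y)‖ := by
    have e : x - y + (l * s) • (x + y) = (1 - l) • (x - y) + l • (x - y + s • (x + y)) := by module
    rw [e]
    refine (norm_add_le _ _).trans ?_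
    rw [norm_smul, norm_smul, Real.norm_of_nonneg hl0.le, Real.norm_of_nonneg (by linarith)]
  have h3 : l * ‖x - y‖ ≤ l * ‖x - y + s • (x + y)‖ := by linarith
  exact le_of_mul_le_mul_left h3 hl0

theorem parallelogram_of_dunklWilliams
    (h : ∀ x y : X, x ≠ 0 → y ≠ 0 → BirkhoffOrthogonal x y →
        ‖‖x‖⁻¹ • x - ‖y‖⁻¹ • y‖ ≤ 2 * ‖x - y‖ / (‖x‖ + ‖y‖)) (v w : X) :
    ‖v + w‖ * ‖v + w‖ + ‖v - w‖ * ‖v - w‖ = 2 * (‖v‖ * ‖v‖ + ‖w‖ * ‖w‖) := by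
  by_cases hli : LinearIndependent ℝ ![v, w]
  · have hN := planeSeminorm_pos hli
    obtain ⟨α, β, P⟩ := exists_angleParam hN
    have key := P.parallelogram hN (by
      intro x y hx hy hxy s
      have := norm_sub_le_norm_sub_add_smul h (x := planeMap v w x) (y := planeMap v w y) hx hy
        (fun t => by
          rw [← map_smul, ← map_add]
          exact hxy t) s
      rwa [← map_sub, ← map_add, ← map_smul, ← map_add] at this) 1 Complex.I
    simp [planeSeminorm_apply, planeMap_apply, ← sub_eq_add_neg] at key
    linarith
  · rcases eq_or_ne v 0 with rfl | hv
    · simp; ring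
    · have : ∃ c : ℝ, c • v = w := by
        by_contra! hc
        exact hli ((LinearIndependent.pair_iff' hv).2 hc)
      obtain ⟨c, rfl⟩ := this
      have e1 : v + c • v = (1 + c) • v := by module
      have e2 : v - c • v = (1 - c) • v := by module
      rw [e1, e2, norm_smul, norm_smul, norm_smul, Real.norm_eq_abs, Real.norm_eq_abs,
        Real.norm_eq_abs]
      have a1 := abs_mul_abs_self (1 + c)
      have a2 := abs_mul_abs_self (1 - c)
      have a3 := abs_mul_abs_self c
      linear_combination ‖v‖ * ‖v‖ * (a1 + a2 - 2 * a3)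

/-- After squaring, with `c` the cosine of the angle and `a`, `b` the norms, the two sides differ by
`2 * (1 + c) * (a - b) ^ 2`. -/
theorem IsInnerProductSpace.dunklWilliams (hX : IsInnerProductSpace X) {x y : X} (hx : x ≠ 0)
    (hy : y ≠ 0) : ‖‖x‖⁻¹ • x - ‖y‖⁻¹ • y‖ ≤ 2 * ‖x - y‖ / (‖x‖ + ‖y‖) := by
  obtain ⟨I, rfl⟩ := hX
  have px := norm_pos_iff.2 hx
  have py := norm_pos_iff.2 hy
  rw [le_div_iff₀ (by positivity)]
  refine le_of_sq_le_sq ?_ (by positivity)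
  rw [mul_pow, mul_pow, norm_sub_sq_real, norm_sub_sq_real, norm_smul, norm_smul,
    real_inner_smul_left, real_inner_smul_right, norm_inv, norm_inv, norm_norm, norm_norm,
    inv_mul_cancel₀ px.ne', inv_mul_cancel₀ py.ne']
  have hc := (abs_le.1 (abs_real_inner_le_norm x y)).1
  set i := inner ℝ x y
  set a := ‖x‖
  set b := ‖y‖
  set c := a⁻¹ * (b⁻¹ * i) with hcd
  have hi : i = c * (a * b) := by rw [hcd]; field_simp
  have hc1 : -1 ≤ c := by
    rw [hi] at hc
    have : 0 < a * b := by positivity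
    nlinarith
  rw [hi]
  nlinarith [mul_nonneg (by linarith : 0 ≤ 1 + c) (sq_nonneg (a - b))]

theorem BirkhoffOrthogonal.norm_sub_pos {x y : X} (hx : x ≠ 0) (h : BirkhoffOrthogonal x y) :
    0 < ‖x - y‖ := by
  have := h (-1)
  rw [neg_one_smul, ← sub_eq_add_neg] at this
  exact (norm_pos_iff.2 hx).trans_le this

theorem dunklWilliamsQuotient_le_two_iff {x y : X} (hx : x ≠ 0) (h : BirkhoffOrthogonal x y) :
    dunklWilliamsQuotient x y ≤ 2 ↔
      ‖‖x‖⁻¹ • x - ‖y‖⁻¹ • y‖ ≤ 2 * ‖x - y‖ / (‖x‖ + ‖y‖) := by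
  have h1 := h.norm_sub_pos hx
  have h2 : 0 < ‖x‖ + ‖y‖ := add_pos_of_pos_of_nonneg (norm_pos_iff.2 hx) (norm_nonneg y)
  rw [dunklWilliamsQuotient, le_div_iff₀ h2, div_mul_eq_mul_div, div_le_iff₀ h1, mul_comm (‖x‖ + ‖y‖)]

theorem IsInnerProductSpace.exists_quotient_eq_two (hX : IsInnerProductSpace X)
    (hr : 2 ≤ Module.rank ℝ X) : ∃ x y : X, x ≠ 0 ∧ y ≠ 0 ∧ BirkhoffOrthogonal x y ∧
      dunklWilliamsQuotient x y = 2 := by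
  obtain ⟨I, rfl⟩ := hX
  have hr1 : 1 < Module.rank ℝ X := lt_of_lt_of_le (by norm_num) hr
  obtain ⟨v, hv⟩ := rank_pos_iff_exists_ne_zero.1 (zero_lt_one.trans hr1)
  obtain ⟨w, hw⟩ := exists_linearIndependent_pair_of_one_lt_rank hr1 hv
  set e := InnerProductSpace.gramSchmidtNormed ℝ ![v, w] with he
  have ho : Orthonormal ℝ e := InnerProductSpace.gramSchmidtNormed_orthonormal hw
  have n0 : ‖e 0‖ = 1 := ho.1 0
  have n1 : ‖e 1‖ = 1 := ho.1 1
  have h0 : e 0 ≠ 0 := ho.ne_zero 0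
  have hB : BirkhoffOrthogonal (e 0) (e 1) := by
    intro t
    refine le_of_sq_le_sq ?_ (norm_nonneg _)
    rw [norm_add_sq_real, real_inner_smul_right, ho.2 (by decide : (0 : Fin 2) ≠ 1)]
    nlinarith [sq_nonneg ‖t • e 1‖]
  refine ⟨e 0, e 1, h0, ho.ne_zero 1, hB, ?_⟩
  have := hB.norm_sub_pos h0
  rw [dunklWilliamsQuotient, n0, n1, inv_one, one_smul, one_smul, div_mul_cancel₀ _ this.ne']
  norm_num

end Plane

/-! ### The two characterizations. -/

theorem isInnerProductSpace_iff_dunklWilliams (X : Type*) [NormedAddCommGroup X]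
    [NormedSpace ℝ X] : IsInnerProductSpace X ↔
      ∀ x y : X, x ≠ 0 → y ≠ 0 → BirkhoffOrthogonal x y →
        ‖‖x‖⁻¹ • x - ‖y‖⁻¹ • y‖ ≤ 2 * ‖x - y‖ / (‖x‖ + ‖y‖) :=
  ⟨fun hX _ _ hx hy _ => hX.dunklWilliams hx hy,
    fun h => ⟨InnerProductSpace.ofNorm (𝕜 := ℝ) (parallelogram_of_dunklWilliams h), rfl⟩⟩

theorem proposition3 (X : Type*) [NormedAddCommGroup X] [NormedSpace ℝ X] :
    (IsInnerProductSpace X ↔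
      ∀ x y : X, x ≠ 0 → y ≠ 0 → BirkhoffOrthogonal x y →
        ‖‖x‖⁻¹ • x - ‖y‖⁻¹ • y‖ ≤ 2 * ‖x - y‖ / (‖x‖ + ‖y‖)) ∧
    (2 ≤ Module.rank ℝ X → (IsInnerProductSpace X ↔ DWB X = 2)) := by
  refine ⟨isInnerProductSpace_iff_dunklWilliams X, fun hr => ⟨fun hX => ?_, fun h => ?_⟩⟩
  · apply le_antisymm
    · apply sSup_le
      rintro _ ⟨x, y, hx, hy, hxy, rfl⟩
      exact EReal.coe_le_coe_iff.2 <| (dunklWilliamsQuotient_le_two_iff hx hxy).2 (hX.dunklWilliams hx hy)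
    · obtain ⟨x, y, hx, hy, hxy, hq⟩ := hX.exists_quotient_eq_two hr
      exact le_sSup ⟨x, y, hx, hy, hxy, by rw [hq]; rfl⟩
  · rw [isInnerProductSpace_iff_dunklWilliams]
    intro x y hx hy hxy
    rw [← dunklWilliamsQuotient_le_two_iff hx hxy]
    have : ((dunklWilliamsQuotient x y : ℝ) : EReal) ≤ 2 :=
      h ▸ le_sSup ⟨x, y, hx, hy, hxy, rfl⟩
    exact EReal.coe_le_coe_iff.1 this
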